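/- For $|p|<1$ and $z\in\mathbb C^\times$ let $(a;p)_\infty=\prod_{n\ge 0}(1-ap^n)$, $\theta(z;p)=(z;p)_\infty(pz^{-1};p)_\infty$, $\theta(t;p;q)_n=\prod_{m=0}^{n-1}\theta(tq^m;p)$. Let $r\ge 0$ be an integer, $\tau\in\mathbb C$ with $\mathrm{Im}\,\tau>0$, $p=e^{2\pi i\tau}$, let $N,M\in\mathbb Z$ with $\gcd(N,M)=1$, let $\chi$ be a real irrational number, and put $q=e^{2\pi i\chi(N+M\tau)}$ and $q^{x}:=e^{2\pi i\chi x(N+M\tau)}$ for $x\in\mathbb R$. Let $t_0=q$ and let $t_1,\dots,t_r,w_1,\dots,w_r\in\mathbb C^\times$ satisfy the balancing condition $\prod_{k=0}^r t_k=q\prod_{k=1}^r w_k$. Assume that modulo $p^{\mathbb Z}$ none of $t_1,\dots,t_r,w_1,\dots,w_r$ lies on the line $q^{\mathbb R}$, i.e. $t_k\notin p^{\mathbb Z}q^{\mathbb R}$ and $w_k\notin p^{\mathbb Z}q^{\mathbb R}$ for $1\le k\le r$. Then the elliptic hypergeometric series $${}_{r+1}E_r\left({t_0,\dots,t_r\atop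 w_1,\dots,w_r};q,p\,\Big|\,z\right)=\sum_{n=0}^\infty\frac{\prod_{k=0}^{r}\theta(t_k;p;q)_n}{\theta(q;p;q)_n\prod_{k=1}^r\theta(w_k;p;q)_n}\,z^n$$ has a finite positive radius of convergence $r_c$, given by $$\log r_c^{-1}=\sum_{k=1}^r\left(\frac{\log^2|t_k|-\log^2|w_k|}{4\pi\,\mathrm{Im}\,\tau}+\frac{\pi\,\mathrm{Im}\,\tau}{|N+M\tau|^2}\big(\alpha_k(\alpha_k-1)-\beta_k(\beta_k-1)\big)\right),$$ where $$\alpha_k=\left\{\frac{\mathrm{Re}\big((N+M\tau)\log\bar w_k\big)}{2\pi\,\mathrm{Im}\,\tau}\right\},\qquad \beta_k=\left\{\frac{\mathrm{Re}\big((N+M\tau)\log\bar t_k\big)}{2\pi\,\mathrm{Im}\,\tau}\right\},$$ and $\{x\}$ denotes the fractional part of $x$ (the choice of the branch of the logarithm does not matter, since $M$ is an integer). -/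

import Mathlib

noncomputable section

/-- The infinite product `(a; p)_∞ = ∏_{n ≥ 0} (1 - a p^n)` (for `|p| < 1`). -/
def pPochInf (a p : ℂ) : ℂ := ∏' n : ℕ, (1 - a * p ^ n)

/-- The multiplicative Jacobi theta function `θ(z; p) = (z; p)_∞ (p z⁻¹; p)_∞`,
for `z ≠ 0` and `|p| < 1`. -/
def mulTheta (z p : ℂ) : ℂ := pPochInf z p * pPochInf (p * z⁻¹) p

/-- The elliptic shifted factorial `θ(t; p; q)_n = ∏_{m=0}^{n-1} θ(t q^m; p)`. -/
def ellPoch (t p q : ℂ) (n : ℕ) : ℂ := ∏ m ∈ Finset.range n, mulTheta (t * q ^ m) p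

/-- The coefficient of `z^n` in the theta hypergeometric series
`_s E_r(t_0, …, t_{s-1}; w_1, …, w_r; q, p | z)`. -/
def thetaHypCoeff {s r : ℕ} (t : Fin s → ℂ) (w : Fin r → ℂ) (q p : ℂ) (n : ℕ) : ℂ :=
  (∏ j : Fin s, ellPoch (t j) p q n) / (ellPoch q p q n * ∏ k : Fin r, ellPoch (w k) p q n)

/-- The theta hypergeometric series `_s E_r` as a formal power series in `z`. -/
def thetaHypSeries {s r : ℕ} (t : Fin s → ℂ) (w : Fin r → ℂ) (q p : ℂ) :
    FormalMultilinearSeries ℂ ℂ ℂ :=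
  FormalMultilinearSeries.ofScalars ℂ (thetaHypCoeff t w q p)

/-- The fractional part of `Re((N + M τ) log (conj z)) / (2 π Im τ)`. Changing the branch of the
logarithm shifts the argument of the fractional part by a multiple of the integer `M`. -/
def lineFract (N M : ℤ) (τ z : ℂ) : ℝ :=
  Int.fract ((((N : ℂ) + (M : ℂ) * τ) * Complex.log (starRingEnd ℂ z)).re / (2 * Real.pi * τ.im))

end

/-! Put `t = exp (2πix)`. Multiplying `q` into the argument moves `x` along the direction `ω = N + M
τ` with irrational step `χ`, so the root test asks for averages of `log ‖addTheta‖` along this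
orbit. A Gaussian factor turns `‖addTheta‖` into the doubly periodic `normTheta`. Along `ω` its
logarithm is 1-periodic, and continuous when the line misses the lattice, so Weyl equidistribution
(`tendsto_average_periodic`) yields the limit `lineMean`.

The Gaussian correction leaves three kinds of terms: a constant in `(Im x)²`, which produces the
`log²` terms; a possibly growing sum multiplied by `Im x`, cancelled by the modulus of the balancing
condition; and a sum independent of `x`, cancelled between numerator and denominator
(`log_norm_ellPoch`).

It remains to find `lineMean`. Between consecutive parallel lines through lattice points, theta has
a holomorphic logarithm whose increment along `ω` is affine, so its mean is a quadratic polynomial.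
Restricted to a transverse lattice vector, its leading coefficient is explicit and evenness fixes
the linear one. This gives `exists_lineMean_eq`, up to a constant that cancels between `t_k` and
`w_k`. -/

open Filter Topology

/-! ### Primitives and holomorphic logarithms on convex domains. -/

/-- A holomorphic function on a convex open set has a primitive there. -/
theorem Convex.exists_hasDerivAt_of_differentiableOn {s : Set ℂ} (hs : Convex ℝ s) (hso : IsOpen s)
    {f : ℂ → ℂ} (hf : DifferentiableOn ℂ f s) : ∃ F : ℂ → ℂ, ∀ z ∈ s, HasDerivAt F (f z) z := by
  -- The one-form `f dz` is closed: its derivative `(a, b) ↦ f' a b` is symmetric, so the Poincaré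
  -- lemma applies.
  set L : ℂ →L[ℂ] (ℂ →L[ℂ] ℂ) := (ContinuousLinearMap.lsmul ℂ ℂ : ℂ →L[ℂ] ℂ →L[ℂ] ℂ)
  have hω : ∀ x ∈ s, HasFDerivWithinAt (fun z ↦ L (f z))
      ((L.restrictScalars ℝ).comp
        ((ContinuousLinearMap.toSpanSingleton ℂ (deriv f x)).restrictScalars ℝ)) s x := by
    intro x hx
    have h := ((hf x hx).differentiableAt (hso.mem_nhds hx)).hasDerivAt.hasFDerivAt
    exact (L.hasFDerivAt.comp x h).restrictScalars ℝ |>.hasFDerivWithinAt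
  obtain ⟨F, hF⟩ := hs.exists_forall_hasFDerivWithinAt_of_hasFDerivWithinAt_symmetric hω
    (fun a _ x _ y _ ↦ by simp [L]; ring)
  refine ⟨F, fun z hz ↦ ?_⟩
  have := ((hF z hz).hasFDerivAt (hso.mem_nhds hz)).hasDerivAt
  simpa [L] using this

theorem Convex.eq_of_hasDerivAt_zero {s : Set ℂ} (hs : Convex ℝ s) (hso : IsOpen s) {f : ℂ → ℂ}
    (hf : ∀ z ∈ s, HasDerivAt f 0 z) {a z : ℂ} (ha : a ∈ s) (hz : z ∈ s) : f z = f a :=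
  hs.is_const_of_fderivWithin_eq_zero (𝕜 := ℂ)
    (fun w hw ↦ (hf w hw).differentiableAt.differentiableWithinAt)
    (fun w hw ↦ by
      rw [((hf w hw).hasFDerivAt.hasFDerivWithinAt).fderivWithin (hso.uniqueDiffWithinAt hw)]
      ext; simp) hz ha

/-- A nowhere vanishing holomorphic function on a convex open set has a holomorphic logarithm. -/
theorem Convex.exists_differentiableOn_exp_eq {s : Set ℂ} (hs : Convex ℝ s) (hso : IsOpen s)
    {g : ℂ → ℂ} (hg : DifferentiableOn ℂ g s) (h0 : ∀ z ∈ s, g z ≠ 0) :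
    ∃ l : ℂ → ℂ, DifferentiableOn ℂ l s ∧ ∀ z ∈ s, Complex.exp (l z) = g z := by
  obtain ⟨F, hF⟩ := hs.exists_hasDerivAt_of_differentiableOn hso
    (f := fun z ↦ deriv g z / g z) ((hg.deriv hso).div hg h0)
  rcases s.eq_empty_or_nonempty with rfl | ⟨a, ha⟩
  · exact ⟨0, by simp⟩
  have hd : ∀ z ∈ s, HasDerivAt (fun z ↦ g z * Complex.exp (-F z)) 0 z := by
    intro z hz
    have h1 := ((hg z hz).differentiableAt (hso.mem_nhds hz)).hasDerivAt
    have h2 := (hF z hz).neg.cexp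
    have h3 := h0 z hz
    have e : deriv g z * Complex.exp (-F z) + g z * (Complex.exp (-F z) * -(deriv g z / g z))
        = 0 := by
      field_simp
      ring
    exact e ▸ h1.mul h2
  have hc : ∀ z ∈ s, g z * Complex.exp (-F z) = g a * Complex.exp (-F a) := fun z hz ↦
    hs.eq_of_hasDerivAt_zero hso hd ha hz
  refine ⟨fun z ↦ F z - F a + Complex.log (g a), fun z hz ↦ ?_, fun z hz ↦ ?_⟩
  · exact (((hF z hz).differentiableAt.sub_const _).add_const _).differentiableWithinAt
  · have := hc z hz
    rw [Complex.exp_add, Complex.exp_log (h0 a ha), Complex.exp_sub]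
    rw [Complex.exp_neg, Complex.exp_neg] at this
    field_simp at this ⊢
    rw [this]

/-! ### Weyl equidistribution on the circle. -/

/-- Weyl's equidistribution theorem for the trigonometric monomials. -/
theorem tendsto_average_fourier {χ : ℝ} (hχ : Irrational χ) (k : ℤ) :
    Tendsto (fun n : ℕ ↦ (n : ℂ)⁻¹ * ∑ m ∈ Finset.range n,
      fourier k (((m * χ : ℝ)) : AddCircle (1 : ℝ))) atTop
      (𝓝 (∫ s in (0 : ℝ)..1, fourier k (s : AddCircle (1 : ℝ)))) := by
  simp only [fourier_coe_apply]
  rcases eq_or_ne k 0 with rfl | hk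
  · simp only [Int.cast_zero, mul_zero, zero_mul, zero_div, Complex.exp_zero]
    refine tendsto_const_nhds.congr' ?_
    filter_upwards [eventually_gt_atTop 0] with n hn
    have : (n : ℂ) ≠ 0 := by exact_mod_cast hn.ne'
    simp [this]
  set c : ℂ := 2 * Real.pi * Complex.I * k with hc
  have hc0 : c ≠ 0 := by simp [hc, hk, Real.pi_ne_zero]
  have hint : (∫ s in (0 : ℝ)..1, Complex.exp (c * (s : ℂ) / (1 : ℝ))) = 0 := by
    have := integral_exp_mul_complex (a := 0) (b := 1) hc0
    simp only [Complex.ofReal_one, div_one]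
    rw [this]
    have : Complex.exp c = 1 := Complex.exp_eq_one_iff.2 ⟨k, by rw [hc]; ring⟩
    simp [this]
  rw [hint]
  set z : ℂ := Complex.exp (c * χ) with hz
  have hz1 : z ≠ 1 := by
    intro h
    obtain ⟨j, hj⟩ := Complex.exp_eq_one_iff.1 h
    have h2 : (2 * Real.pi * Complex.I : ℂ) ≠ 0 := by simp [Real.pi_ne_zero]
    have h3 : ((k * χ : ℝ) : ℂ) = (j : ℝ) := by
      push_cast
      apply mul_left_cancel₀ h2
      rw [hc] at hj
      linear_combination hj
    exact (hχ.intCast_mul hk).ne_int j (by exact_mod_cast h3)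
  have hnz : ∀ n : ℕ, ‖z ^ n‖ = 1 := by
    intro n
    rw [norm_pow, hz, hc, show (2 * Real.pi * Complex.I * k * χ : ℂ)
      = ((2 * Real.pi * k * χ : ℝ) : ℂ) * Complex.I by push_cast; ring,
      Complex.norm_exp_ofReal_mul_I, one_pow]
  -- The geometric sum stays bounded by `2 / ‖z - 1‖`, so its average is `O(1/n)`.
  refine squeeze_zero_norm (a := fun n : ℕ ↦ (n : ℝ)⁻¹ * (2 / ‖z - 1‖)) (fun n ↦ ?_) ?_
  · have : ∑ m ∈ Finset.range n, Complex.exp (c * ((m * χ : ℝ) : ℂ) / (1 : ℝ))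
        = (z ^ n - 1) / (z - 1) := by
      rw [← geom_sum_eq hz1]
      refine Finset.sum_congr rfl fun m _ ↦ ?_
      rw [hz, ← Complex.exp_nat_mul]
      push_cast
      congr 1
      ring
    rw [this, norm_mul, norm_inv, Complex.norm_natCast, norm_div]
    gcongr
    calc ‖z ^ n - 1‖ ≤ ‖z ^ n‖ + ‖(1 : ℂ)‖ := norm_sub_le _ _
      _ = 2 := by rw [hnz]; norm_num
  · simpa using (tendsto_inv_atTop_nhds_zero_nat (𝕜 := ℝ)).mul_const (2 / ‖z - 1‖)

/-- The averages of a fixed orbit are contractive in the uniform norm. -/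
theorem norm_average_le (f : C(AddCircle (1 : ℝ), ℂ)) (χ : ℝ) (n : ℕ) :
    ‖(n : ℂ)⁻¹ * ∑ m ∈ Finset.range n, f (((m * χ : ℝ)) : AddCircle (1 : ℝ))‖ ≤ ‖f‖ := by
  rw [norm_mul, norm_inv, Complex.norm_natCast]
  rcases Nat.eq_zero_or_pos n with rfl | hn
  · simp
  have h : ‖∑ m ∈ Finset.range n, f (((m * χ : ℝ)) : AddCircle (1 : ℝ))‖ ≤ n * ‖f‖ := by
    refine (norm_sum_le _ _).trans ?_
    calc _ ≤ ∑ m ∈ Finset.range n, ‖f‖ := Finset.sum_le_sum fun i _ ↦ f.norm_coe_le_norm _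
      _ = n * ‖f‖ := by simp
  have hn' : (0 : ℝ) < n := by exact_mod_cast hn
  rw [inv_mul_le_iff₀ hn']
  exact h

/-- Weyl's equidistribution theorem on the circle. -/
theorem tendsto_average_addCircle {χ : ℝ} (hχ : Irrational χ) (f : C(AddCircle (1 : ℝ), ℂ)) :
    Tendsto (fun n : ℕ ↦ (n : ℂ)⁻¹ * ∑ m ∈ Finset.range n,
      f (((m * χ : ℝ)) : AddCircle (1 : ℝ))) atTop
      (𝓝 (∫ s in (0 : ℝ)..1, f (s : AddCircle (1 : ℝ)))) := by
  have hcts : ∀ g : C(AddCircle (1 : ℝ), ℂ), Continuous fun s : ℝ ↦ g (s : AddCircle (1 : ℝ)) :=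
    fun g ↦ g.continuous.comp (AddCircle.continuous_mk' 1)
  -- Convergence of averages is a linear condition; it holds on the span of the Fourier monomials,
  -- which is dense.
  let W : Submodule ℂ C(AddCircle (1 : ℝ), ℂ) :=
    { carrier := {g | Tendsto (fun n : ℕ ↦ (n : ℂ)⁻¹ * ∑ m ∈ Finset.range n,
        g (((m * χ : ℝ)) : AddCircle (1 : ℝ))) atTop
        (𝓝 (∫ s in (0 : ℝ)..1, g (s : AddCircle (1 : ℝ))))}
      add_mem' := fun {a b} ha hb ↦ by
        have := Tendsto.add ha hb
        simp only [Set.mem_ofPred_eq, ContinuousMap.add_apply, Finset.sum_add_distrib, mul_add]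
        rwa [intervalIntegral.integral_add ((hcts a).intervalIntegrable _ _)
          ((hcts b).intervalIntegrable _ _)]
      zero_mem' := by simp
      smul_mem' := fun c a ha ↦ by
        have := Tendsto.const_mul c ha
        simp only [Set.mem_ofPred_eq, ContinuousMap.smul_apply, smul_eq_mul, ← Finset.mul_sum,
          intervalIntegral.integral_const_mul]
        exact this.congr fun n ↦ by ring }
  have hspan : Submodule.span ℂ (Set.range (@fourier 1)) ≤ W := by
    rw [Submodule.span_le]
    rintro _ ⟨k, rfl⟩
    exact tendsto_average_fourier hχ k
  have hf : f ∈ (Submodule.span ℂ (Set.range (@fourier 1))).topologicalClosure := by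
    rw [span_fourier_closure_eq_top]; trivial
  rw [← SetLike.mem_coe, Submodule.topologicalClosure_coe, Metric.mem_closure_iff] at hf
  rw [Metric.tendsto_atTop]
  intro ε hε
  obtain ⟨g, hg, hfg⟩ := hf (ε / 3) (by positivity)
  obtain ⟨K, hK⟩ := (Metric.tendsto_atTop.1 (hspan hg)) (ε / 3) (by positivity)
  refine ⟨K, fun n hn ↦ ?_⟩
  have h1 := hK n hn
  have h2 := norm_average_le (f - g) χ n
  have h3 : ‖(∫ s in (0 : ℝ)..1, (f - g) (s : AddCircle (1 : ℝ)))‖ ≤ ‖f - g‖ := by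
    simpa using intervalIntegral.norm_integral_le_of_norm_le_const (a := 0) (b := 1)
      (f := fun s : ℝ ↦ (f - g) (s : AddCircle (1 : ℝ))) fun s _ ↦ (f - g).norm_coe_le_norm _
  simp only [ContinuousMap.sub_apply, Finset.sum_sub_distrib, mul_sub] at h2
  simp only [ContinuousMap.sub_apply] at h3
  rw [intervalIntegral.integral_sub ((hcts f).intervalIntegrable _ _)
          ((hcts g).intervalIntegrable _ _)] at h3
  rw [dist_eq_norm] at hfg h1 ⊢
  rw [← norm_neg] at h3
  refine lt_of_le_of_lt ?_ (show ‖f - g‖ + ε / 3 + ‖f - g‖ < ε by linarith)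
  refine le_trans (le_of_eq ?_) ((norm_add₃_le).trans (add_le_add (add_le_add h2 h1.le) h3))
  congr 1
  ring

/-- Weyl's equidistribution theorem for continuous real functions of period one. -/
theorem tendsto_average_periodic {χ : ℝ} (hχ : Irrational χ) {f : ℝ → ℝ} (hf : Continuous f)
    (hper : Function.Periodic f 1) :
    Tendsto (fun n : ℕ ↦ (n : ℝ)⁻¹ * ∑ m ∈ Finset.range n, f (m * χ)) atTop
      (𝓝 (∫ s in (0 : ℝ)..1, f s)) := by
  let g : C(AddCircle (1 : ℝ), ℂ) :=
    ⟨fun x ↦ ((hper.lift x : ℝ) : ℂ), Complex.continuous_ofReal.comp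
      (continuous_coinduced_dom.2 hf)⟩
  have h := tendsto_average_addCircle hχ g
  have hg : ∀ s : ℝ, g (s : AddCircle (1 : ℝ)) = (f s : ℂ) := fun s ↦ by
    simp [g, Function.Periodic.lift_coe]
  simp only [hg] at h
  rw [intervalIntegral.integral_ofReal] at h
  have := (Complex.continuous_re.tendsto _).comp h
  refine this.congr fun n ↦ ?_
  simp only [Function.comp]
  rw [← Complex.ofReal_natCast, ← Complex.ofReal_inv, ← Complex.ofReal_sum, ← Complex.ofReal_mul,
    Complex.ofReal_re]

/-! ### Root test. -/

/-- The root test in logarithmic form. -/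
theorem radius_ofScalars_of_tendsto_log {c : ℕ → ℂ} (hc : ∀ n, c n ≠ 0) {a : ℝ}
    (h : Tendsto (fun n : ℕ ↦ (n : ℝ)⁻¹ * Real.log ‖c n‖) atTop (𝓝 a)) :
    (FormalMultilinearSeries.ofScalars ℂ c).radius = ENNReal.ofReal (Real.exp (-a)) := by
  rw [FormalMultilinearSeries.radius_eq_liminf]
  refine Tendsto.liminf_eq ?_
  have h2 := ENNReal.tendsto_ofReal ((Real.continuous_exp.tendsto _).comp h.neg)
  refine h2.congr fun n ↦ ?_
  have hpos : 0 < ‖c n‖ := norm_pos_iff.2 (hc n)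
  rw [one_div, ← ENNReal.ofReal_coe_nnreal, ← ENNReal.ofReal_inv_of_pos]
  · congr 1
    rw [NNReal.coe_rpow, coe_nnnorm, FormalMultilinearSeries.ofScalars_norm,
      Real.rpow_def_of_pos hpos, ← Real.exp_neg]
    simp [mul_comm]
  · rw [NNReal.coe_rpow, coe_nnnorm, FormalMultilinearSeries.ofScalars_norm]
    positivity

/-! ### Product form of theta: functional equations, zeros, holomorphy. -/

theorem summable_norm_neg_mul_pow {p : ℂ} (hp : ‖p‖ < 1) (a : ℂ) :
    Summable fun n : ℕ ↦ ‖-(a * p ^ n)‖ := by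
  simp only [norm_neg, norm_mul, norm_pow]
  exact (summable_geometric_of_lt_one (norm_nonneg _) hp).mul_left _

theorem multipliable_pPochInf {p : ℂ} (hp : ‖p‖ < 1) (a : ℂ) :
    Multipliable fun n : ℕ ↦ (1 - a * p ^ n) := by
  simpa only [sub_eq_add_neg] using
    multipliable_one_add_of_summable (summable_norm_neg_mul_pow hp a)

theorem pPochInf_eq_mul {p : ℂ} (hp : ‖p‖ < 1) (a : ℂ) :
    pPochInf a p = (1 - a) * pPochInf (p * a) p := by
  have h : Multipliable fun n : ℕ ↦ (1 - a * p ^ (n + 1)) := by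
    refine (multipliable_pPochInf hp (p * a)).congr fun n ↦ ?_
    rw [pow_succ]; ring
  have h2 := tprod_eq_zero_mul' (f := fun n : ℕ ↦ (1 - a * p ^ n)) h
  have h3 : pPochInf (p * a) p = ∏' n : ℕ, (1 - a * p ^ (n + 1)) :=
    tprod_congr fun n ↦ by rw [pow_succ]; ring
  rw [h3, pPochInf, h2, pow_zero, mul_one]

theorem pPochInf_ne_zero {p a : ℂ} (hp : ‖p‖ < 1) (ha : ∀ n : ℕ, a * p ^ n ≠ 1) :
    pPochInf a p ≠ 0 := by
  have := tprod_one_add_ne_zero_of_summable (f := fun n : ℕ ↦ -(a * p ^ n))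
    (fun i h ↦ ha i (by linear_combination -h)) (summable_norm_neg_mul_pow hp a)
  simpa only [pPochInf, ← sub_eq_add_neg] using this

theorem differentiable_pPochInf {p : ℂ} (hp : ‖p‖ < 1) :
    Differentiable ℂ fun a ↦ pPochInf a p := by
  intro a
  have hU : IsOpen (Metric.ball (0 : ℂ) (‖a‖ + 1)) := Metric.isOpen_ball
  have h := Summable.hasProdLocallyUniformlyOn_nat_one_add (f := fun (n : ℕ) (x : ℂ) ↦ -(x * p ^ n)) hU
    (u := fun n : ℕ ↦ (‖a‖ + 1) * ‖p‖ ^ n)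
    ((summable_geometric_of_lt_one (norm_nonneg _) hp).mul_left _)
    (.of_forall fun n x hx ↦ by
      rw [norm_neg, norm_mul, norm_pow]
      have : ‖x‖ < ‖a‖ + 1 := by simpa using hx
      gcongr)
    (fun n ↦ by fun_prop)
  have h2 := h.differentiableOn
    (.of_forall fun _ ↦ by simpa [Finset.prod_fn] using
      DifferentiableOn.finsetProd (fun _ _ ↦ by fun_prop)) hU
  have h3 := (h2 a (by simp)).differentiableAt (hU.mem_nhds (by simp))
  simpa only [pPochInf, ← sub_eq_add_neg] using h3

theorem mulTheta_mul_self {p z : ℂ} (hp : ‖p‖ < 1) (hp0 : p ≠ 0) (hz : z ≠ 0) :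
    mulTheta (p * z) p = -z⁻¹ * mulTheta z p := by
  rw [mulTheta, mulTheta, pPochInf_eq_mul hp z]
  have h1 : p * (p * z)⁻¹ = z⁻¹ := by field_simp
  rw [h1, pPochInf_eq_mul hp z⁻¹]
  field_simp
  ring

theorem mulTheta_inv {p z : ℂ} (hp : ‖p‖ < 1) (hz : z ≠ 0) :
    mulTheta z⁻¹ p = -z⁻¹ * mulTheta z p := by
  rw [mulTheta, mulTheta, pPochInf_eq_mul hp z, pPochInf_eq_mul hp z⁻¹, inv_inv]
  field_simp
  ring

/-- The first product can vanish only at `p^(-n)` with `n ≥ 0`, the second only at `p^(n+1)`. -/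
theorem mulTheta_ne_zero {p z : ℂ} (hp : ‖p‖ < 1) (hp0 : p ≠ 0) (hz : z ≠ 0)
    (h : ∀ j : ℤ, z ≠ p ^ j) : mulTheta z p ≠ 0 := by
  refine mul_ne_zero (pPochInf_ne_zero hp fun n hn ↦ ?_) (pPochInf_ne_zero hp fun n hn ↦ ?_)
  · refine h (-n) ?_
    rw [zpow_neg, zpow_natCast]
    exact eq_inv_of_mul_eq_one_left hn
  · refine h (n + 1) ?_
    rw [zpow_add_one₀ hp0, zpow_natCast]
    field_simp at hn
    rw [← hn, mul_comm]

/-! ### Additive theta function and its doubly periodic modulus. -/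

/-- The additive theta function `x ↦ θ(e^{2πix}; e^{2πiτ})`. -/
noncomputable def addTheta (τ x : ℂ) : ℂ :=
  mulTheta (Complex.exp (2 * Real.pi * Complex.I * x)) (Complex.exp (2 * Real.pi * Complex.I * τ))

theorem norm_nome_lt_one {τ : ℂ} (hτ : 0 < τ.im) :
    ‖Complex.exp (2 * Real.pi * Complex.I * τ)‖ < 1 := by
  rw [Complex.norm_exp, Real.exp_lt_one_iff]
  have : (2 * Real.pi * Complex.I * τ).re = -(2 * Real.pi * τ.im) := by simp
  rw [this]
  have := Real.pi_pos
  simp only [Left.neg_neg_iff]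
  positivity

section

variable {τ : ℂ}

theorem differentiable_addTheta (hτ : 0 < τ.im) : Differentiable ℂ (addTheta τ) := by
  have h := differentiable_pPochInf (norm_nome_lt_one hτ)
  unfold addTheta mulTheta
  refine Differentiable.mul (h.comp (by fun_prop)) (h.comp ?_)
  simp only [← Complex.exp_neg]
  fun_prop

theorem addTheta_add_int (x : ℂ) (n : ℤ) : addTheta τ (x + n) = addTheta τ x := by
  rw [addTheta, addTheta, mul_add, Complex.exp_add,
    Complex.exp_eq_one_iff (x := 2 * Real.pi * Complex.I * n) |>.2 ⟨n, by ring⟩, mul_one]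

theorem addTheta_add_tau (hτ : 0 < τ.im) (x : ℂ) :
    addTheta τ (x + τ) = -Complex.exp (-(2 * Real.pi * Complex.I * x)) * addTheta τ x := by
  rw [addTheta, mul_add, add_comm, Complex.exp_add,
    mulTheta_mul_self (norm_nome_lt_one hτ) (Complex.exp_ne_zero _) (Complex.exp_ne_zero _),
    addTheta, Complex.exp_neg]

theorem addTheta_neg (hτ : 0 < τ.im) (x : ℂ) :
    addTheta τ (-x) = -Complex.exp (-(2 * Real.pi * Complex.I * x)) * addTheta τ x := by
  rw [addTheta, mul_neg, Complex.exp_neg,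
    mulTheta_inv (norm_nome_lt_one hτ) (Complex.exp_ne_zero _), addTheta]

/-- Only the dependence of the multiplier on `x` matters later, so the constant `κ` is left
implicit. -/
theorem addTheta_add_int_mul_tau (hτ : 0 < τ.im) (n : ℤ) :
    ∃ κ : ℂ, κ ≠ 0 ∧ ∀ x, addTheta τ (x + n * τ)
      = κ * Complex.exp (-(2 * Real.pi * Complex.I * n * x)) * addTheta τ x := by
  induction n using Int.induction_on with
  | zero => exact ⟨1, one_ne_zero, fun x ↦ by simp⟩
  | succ n ih =>
    obtain ⟨κ, h0, h⟩ := ih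
    refine ⟨-κ * Complex.exp (-(2 * Real.pi * Complex.I * n * τ)),
      mul_ne_zero (neg_ne_zero.2 h0) (Complex.exp_ne_zero _), fun x ↦ ?_⟩
    have := addTheta_add_tau hτ (x + n * τ)
    push_cast at h ⊢
    rw [show x + ((n : ℂ) + 1) * τ = x + n * τ + τ by ring, this, h x,
      show -(2 * Real.pi * Complex.I * (x + n * τ)) = -(2 * Real.pi * Complex.I * x)
        + -(2 * Real.pi * Complex.I * n * τ) by ring,
      show -(2 * Real.pi * Complex.I * ((n : ℂ) + 1) * x) = -(2 * Real.pi * Complex.I * x)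
        + -(2 * Real.pi * Complex.I * n * x) by ring, Complex.exp_add, Complex.exp_add]
    ring
  | pred n ih =>
    obtain ⟨κ, h0, h⟩ := ih
    refine ⟨-κ * Complex.exp (2 * Real.pi * Complex.I * (-n - 1) * τ),
      mul_ne_zero (neg_ne_zero.2 h0) (Complex.exp_ne_zero _), fun x ↦ ?_⟩
    have := addTheta_add_tau hτ (x + (-n - 1) * τ)
    push_cast at h ⊢
    rw [show x + (-(n : ℂ) - 1) * τ + τ = x + -n * τ by ring, h x] at this
    have h1 : Complex.exp (-(2 * Real.pi * Complex.I * (x + (-n - 1) * τ))) ≠ 0 :=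
      Complex.exp_ne_zero _
    apply mul_left_cancel₀ (neg_ne_zero.2 h1)
    rw [← this]
    have h2 : Complex.exp (-(2 * Real.pi * Complex.I * -n * x))
      = Complex.exp (-(2 * Real.pi * Complex.I * (x + (-n - 1) * τ)))
        * (Complex.exp (2 * Real.pi * Complex.I * (-n - 1) * τ)
        * Complex.exp (-(2 * Real.pi * Complex.I * (-n - 1) * x))) := by
      rw [← Complex.exp_add, ← Complex.exp_add]
      congr 1
      ring
    rw [h2]
    ring

theorem addTheta_ne_zero (hτ : 0 < τ.im) {x : ℂ} (hx : ∀ m n : ℤ, x ≠ m + n * τ) :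
    addTheta τ x ≠ 0 := by
  refine mulTheta_ne_zero (norm_nome_lt_one hτ) (Complex.exp_ne_zero _) (Complex.exp_ne_zero _)
    fun j hj ↦ ?_
  rw [← Complex.exp_int_mul, Complex.exp_eq_exp_iff_exists_int] at hj
  obtain ⟨n, hn⟩ := hj
  refine hx n j ?_
  have h2 : (2 * Real.pi * Complex.I : ℂ) ≠ 0 := by simp [Real.pi_ne_zero]
  apply mul_left_cancel₀ h2
  linear_combination hn

/-- The modulus of the theta function, normalized to be doubly periodic. -/
noncomputable def normTheta (τ x : ℂ) : ℝ :=
  ‖addTheta τ x‖ * Real.exp (-(Real.pi / τ.im * x.im ^ 2) + Real.pi * x.im)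

theorem continuous_normTheta (hτ : 0 < τ.im) : Continuous (normTheta τ) := by
  have := (differentiable_addTheta hτ).continuous
  unfold normTheta
  fun_prop

theorem normTheta_pos {x : ℂ} (hx : addTheta τ x ≠ 0) : 0 < normTheta τ x :=
  mul_pos (norm_pos_iff.2 hx) (Real.exp_pos _)

theorem normTheta_add_int (x : ℂ) (n : ℤ) : normTheta τ (x + n) = normTheta τ x := by
  simp [normTheta, addTheta_add_int]

theorem norm_neg_exp_neg (x : ℂ) :
    ‖-Complex.exp (-(2 * Real.pi * Complex.I * x))‖ = Real.exp (2 * Real.pi * x.im) := by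
  rw [norm_neg, Complex.norm_exp]
  congr 1
  simp

/-- The shift changes the Gaussian exponent by `-2π Im x`, exactly offsetting the multiplier; the
linear term `π Im x` absorbs the leftover `-π Im τ`. -/
theorem normTheta_add_tau (hτ : 0 < τ.im) (x : ℂ) : normTheta τ (x + τ) = normTheta τ x := by
  rw [normTheta, normTheta, addTheta_add_tau hτ, norm_mul, norm_neg_exp_neg,
    mul_comm (Real.exp _), mul_assoc, ← Real.exp_add]
  congr 2
  rw [Complex.add_im]
  field_simp
  ring

theorem normTheta_neg (hτ : 0 < τ.im) (x : ℂ) : normTheta τ (-x) = normTheta τ x := by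
  rw [normTheta, normTheta, addTheta_neg hτ, norm_mul, norm_neg_exp_neg,
    mul_comm (Real.exp _), mul_assoc, ← Real.exp_add]
  congr 2
  rw [Complex.neg_im]
  ring

theorem normTheta_add_lattice (hτ : 0 < τ.im) (x : ℂ) (m n : ℤ) :
    normTheta τ (x + (m + n * τ)) = normTheta τ x := by
  have h : Function.Periodic (normTheta τ) τ := normTheta_add_tau hτ
  have h2 := h.int_mul n (x + m)
  rw [← add_assoc, h2, normTheta_add_int]

theorem log_norm_addTheta {x : ℂ} (hx : addTheta τ x ≠ 0) :
    Real.log ‖addTheta τ x‖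
      = Real.log (normTheta τ x) + Real.pi / τ.im * x.im ^ 2 - Real.pi * x.im := by
  rw [normTheta, Real.log_mul (norm_ne_zero_iff.2 hx) (Real.exp_ne_zero _), Real.log_exp]
  ring

end

/-! ### Means along a line in a zero-free strip. -/

/-- On a convex open set invariant under translation by `ω`, the mean of `log ‖g‖` along `ω` of a
nonvanishing quasi-periodic holomorphic function is the real part of a quadratic polynomial. -/
theorem exists_integral_log_norm_eq_quadratic {s : Set ℂ} (hs : Convex ℝ s) (hso : IsOpen s)
    {g : ℂ → ℂ} (hg : DifferentiableOn ℂ g s) (h0 : ∀ z ∈ s, g z ≠ 0) {ω κ k : ℂ} (hω : ω ≠ 0)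
    (hsω : ∀ x ∈ s, ∀ t : ℝ, x + t * ω ∈ s)
    (hper : ∀ x ∈ s, g (x + ω) = κ * Complex.exp (-(k * x)) * g x) :
    ∃ c c' : ℂ, ∀ x ∈ s, (∫ t in (0 : ℝ)..1, Real.log ‖g (x + t * ω)‖)
      = (-(k / (2 * ω)) * x ^ 2 + c * x + c').re := by
  rcases s.eq_empty_or_nonempty with rfl | ⟨a, ha⟩
  · exact ⟨0, 0, by simp⟩
  obtain ⟨l, hl, hexp⟩ := hs.exists_differentiableOn_exp_eq hso hg h0
  obtain ⟨B, hB⟩ := hs.exists_hasDerivAt_of_differentiableOn hso hl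
  have hsω1 : ∀ x ∈ s, x + ω ∈ s := fun x hx ↦ by simpa using hsω x hx 1
  have hld : ∀ x ∈ s, HasDerivAt l (deriv l x) x := fun x hx ↦
    ((hl x hx).differentiableAt (hso.mem_nhds hx)).hasDerivAt
  have hexp2 : ∀ x ∈ s, Complex.exp (l (x + ω) - l x + k * x) = κ := fun x hx ↦ by
    rw [Complex.exp_add, Complex.exp_sub, hexp _ (hsω1 x hx), hexp x hx, hper x hx,
      Complex.exp_neg]
    have := h0 x hx
    field_simp
  -- The exponential of this function is the constant `κ`, so its own derivative vanishes.
  have hD : ∀ x ∈ s, HasDerivAt (fun x ↦ l (x + ω) - l x + k * x) 0 x := fun x hx ↦ by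
    have h1 : HasDerivAt (fun x ↦ l (x + ω) - l x + k * x)
        (deriv l (x + ω) - deriv l x + k * 1) x :=
      (((hld _ (hsω1 x hx)).comp_add_const x ω).sub (hld x hx)).add
        ((hasDerivAt_id x).const_mul k)
    have h2 := h1.cexp
    have h3 : HasDerivAt (fun x ↦ Complex.exp (l (x + ω) - l x + k * x)) 0 x := by
      refine (hasDerivAt_const x κ).congr_of_eventuallyEq ?_
      filter_upwards [hso.mem_nhds hx] with y hy using hexp2 y hy
    have h4 := h2.unique h3
    rwa [(mul_eq_zero.1 h4).resolve_left (Complex.exp_ne_zero _)] at h1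
  set c0 := l (a + ω) - l a + k * a with hc0
  have hDc : ∀ x ∈ s, l (x + ω) - l x = c0 - k * x := fun x hx ↦ by
    have := hs.eq_of_hasDerivAt_zero hso hD ha hx
    rw [hc0, ← this]
    ring
  -- With `B` a primitive of `l`, `(B (x + ω) - B x) / ω` is the mean of `l` along `ω`; its
  -- derivative is affine by `hDc`, so subtracting a quadratic leaves a constant.
  have hA : ∀ x ∈ s, HasDerivAt
      (fun x ↦ (B (x + ω) - B x) / ω + (k / (2 * ω)) * x ^ 2 - c0 / ω * x) 0 x := fun x hx ↦ by
    have h1 := ((((hB _ (hsω1 x hx)).comp_add_const x ω).sub (hB x hx)).div_const ω |>.add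
      ((hasDerivAt_pow 2 x).const_mul (k / (2 * ω)))).sub ((hasDerivAt_id x).const_mul (c0 / ω))
    have e : (l (x + ω) - l x) / ω + k / (2 * ω) * ((2 : ℕ) * x ^ (2 - 1)) - c0 / ω * 1 = 0 := by
      rw [hDc x hx]
      push_cast
      field_simp
      ring
    rw [← e]
    exact h1
  refine ⟨c0 / ω, (B (a + ω) - B a) / ω + (k / (2 * ω)) * a ^ 2 - c0 / ω * a, fun x hx ↦ ?_⟩
  have hAc := hs.eq_of_hasDerivAt_zero hso hA ha hx
  have hcont : Continuous fun t : ℝ ↦ l (x + t * ω) := continuous_iff_continuousAt.2 fun t ↦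
    ContinuousAt.comp (f := fun t : ℝ ↦ x + t * ω) (g := l)
      ((hld _ (hsω x hx t)).continuousAt) (by fun_prop)
  have hFTC := intervalIntegral.integral_eq_sub_of_hasDerivAt (a := 0) (b := 1)
    (f := fun t : ℝ ↦ B (x + t * ω)) (f' := fun t : ℝ ↦ l (x + t * ω) * ω)
    (fun t _ ↦ by
      have h1 : HasDerivAt (fun t : ℂ ↦ x + t * ω) ω (t : ℂ) := by
        simpa using ((hasDerivAt_id (t : ℂ)).mul_const ω).const_add x
      have h2 := HasDerivAt.comp (t : ℂ) (hB _ (hsω x hx t)) h1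
      exact h2.comp_ofReal)
    ((hcont.mul continuous_const).intervalIntegrable _ _)
  rw [intervalIntegral.integral_mul_const] at hFTC
  have hre : (∫ t in (0 : ℝ)..1, Real.log ‖g (x + t * ω)‖)
      = (∫ t in (0 : ℝ)..1, l (x + t * ω)).re := by
    have := Complex.reCLM.intervalIntegral_comp_comm (hcont.intervalIntegrable
      (μ := MeasureTheory.volume) 0 1)
    rw [← Complex.reCLM_apply, ← this]
    refine intervalIntegral.integral_congr fun t _ ↦ ?_
    simp only [Complex.reCLM_apply]
    rw [← hexp _ (hsω x hx t), Complex.norm_exp, Real.log_exp]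
  rw [hre]
  congr 1
  have e1 : (∫ t in (0 : ℝ)..1, l (x + t * ω)) = (B (x + ω) - B x) / ω := by
    rw [eq_div_iff hω, hFTC]
    simp
  rw [e1, ← hAc]
  ring

/-! ### Transverse coordinate and means over closed geodesics. -/

/-- The coordinate of `x` transverse to the period `N + M τ`; it is integral on `ℤ + ℤ τ`. -/
noncomputable def lineCoord (N M : ℤ) (τ x : ℂ) : ℝ :=
  ((M * τ.im) * x.re - (N + M * τ.re) * x.im) / τ.im

section

variable {τ : ℂ} (N M : ℤ)

theorem lineCoord_add (x y : ℂ) :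
    lineCoord N M τ (x + y) = lineCoord N M τ x + lineCoord N M τ y := by
  simp only [lineCoord, Complex.add_re, Complex.add_im]
  ring

theorem lineCoord_ofReal_mul (t : ℝ) (x : ℂ) :
    lineCoord N M τ (t * x) = t * lineCoord N M τ x := by
  simp only [lineCoord, Complex.re_ofReal_mul, Complex.im_ofReal_mul]
  ring

theorem lineCoord_lattice (hτ : 0 < τ.im) (m n : ℤ) :
    lineCoord N M τ (m + n * τ) = M * m - N * n := by
  simp only [lineCoord, Complex.add_re, Complex.add_im, Complex.intCast_re, Complex.intCast_im,
    Complex.mul_re, Complex.mul_im]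
  field_simp
  ring

theorem lineCoord_period (hτ : 0 < τ.im) : lineCoord N M τ (N + M * τ) = 0 := by
  rw [lineCoord_lattice N M hτ]
  ring

theorem continuous_lineCoord : Continuous (lineCoord N M τ) := by
  unfold lineCoord
  fun_prop

theorem addTheta_ne_zero_of_lineCoord (hτ : 0 < τ.im) {x : ℂ}
    (hx : ∀ n : ℤ, lineCoord N M τ x ≠ n) : addTheta τ x ≠ 0 := by
  refine addTheta_ne_zero hτ fun m n h ↦ hx (M * m - N * n) ?_
  rw [h, lineCoord_lattice N M hτ]
  push_cast
  ring

variable {N M}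

theorem period_ne_zero (hτ : 0 < τ.im) (h : Int.gcd N M = 1) : (N : ℂ) + M * τ ≠ 0 := by
  intro h0
  have h1 := congr_arg Complex.im h0
  simp only [Complex.add_im, Complex.intCast_im, Complex.mul_im, Complex.intCast_re, zero_mul,
    zero_add, add_zero, Complex.zero_im, mul_eq_zero, hτ.ne', or_false] at h1
  have hM : M = 0 := by exact_mod_cast h1
  subst hM
  have hN : N = 0 := by simpa using h0
  simp [hN] at h

theorem exists_eq_add_period {x e : ℂ} (hτ : 0 < τ.im) (h : Int.gcd N M = 1)
    (he : lineCoord N M τ e = 1) :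
    ∃ u : ℝ, x = lineCoord N M τ x * e + u * (N + M * τ) := by
  set ω : ℂ := N + M * τ with hω
  have hω0 : ω ≠ 0 := period_ne_zero hτ h
  set y := x - lineCoord N M τ x * e with hy
  have hy0 : lineCoord N M τ y = 0 := by
    have := lineCoord_add N M (τ := τ) y (lineCoord N M τ x * e)
    rw [hy, sub_add_cancel, ← hy, lineCoord_ofReal_mul, he] at this
    linarith
  -- Vanishing of the transverse coordinate says that `y` times the conjugate of `ω` is real.
  have him : (y / ω).im = 0 := by
    rw [Complex.div_im]
    have h1 : ω.re = N + M * τ.re := by simp [hω]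
    have h2 : ω.im = M * τ.im := by simp [hω]
    rw [lineCoord, ← h1, ← h2, div_eq_zero_iff] at hy0
    have h3 := hy0.resolve_right hτ.ne'
    rw [← sub_div, div_eq_zero_iff]
    left
    linarith
  refine ⟨(y / ω).re, ?_⟩
  have : ((y / ω).re : ℂ) = y / ω := Complex.ext (by simp) (by simp [him])
  rw [this, div_mul_cancel₀ _ hω0, hy]
  ring

/-- The mean of `log normTheta` along the closed geodesic through `x` in direction `N + M τ`. -/
noncomputable def lineMean (N M : ℤ) (τ x : ℂ) : ℝ :=
  ∫ s in (0 : ℝ)..1, Real.log (normTheta τ (x + s * (N + M * τ)))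

theorem lineMean_add_lattice (hτ : 0 < τ.im) (x : ℂ) (m n : ℤ) :
    lineMean N M τ (x + (m + n * τ)) = lineMean N M τ x := by
  refine intervalIntegral.integral_congr fun s _ ↦ ?_
  rw [add_right_comm, normTheta_add_lattice hτ]

theorem periodic_log_normTheta (hτ : 0 < τ.im) (x : ℂ) :
    Function.Periodic (fun s : ℝ ↦ Real.log (normTheta τ (x + s * (N + M * τ)))) 1 := by
  intro s
  simp only
  rw [← normTheta_add_lattice hτ (x + s * (N + M * τ)) N M]
  congr 2
  push_cast
  ring

theorem lineMean_add_period (hτ : 0 < τ.im) (x : ℂ) (u : ℝ) :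
    lineMean N M τ (x + u * (N + M * τ)) = lineMean N M τ x := by
  have h := (periodic_log_normTheta (N := N) (M := M) hτ x).intervalIntegral_add_eq u 0
  have h2 := intervalIntegral.integral_comp_add_right (a := 0) (b := 1)
    (fun s : ℝ ↦ Real.log (normTheta τ (x + s * (N + M * τ)))) u
  rw [zero_add, add_comm 1 u, h, zero_add] at h2
  rw [lineMean, lineMean, ← h2]
  refine intervalIntegral.integral_congr fun s _ ↦ ?_
  congr 2
  push_cast
  ring

/-- `normTheta` is even, and the substitution `s ↦ 1 - s` restores the orientation up to a period.
-/
theorem lineMean_neg (hτ : 0 < τ.im) (x : ℂ) : lineMean N M τ (-x) = lineMean N M τ x := by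
  have h2 := intervalIntegral.integral_comp_sub_left (a := 0) (b := 1)
    (fun s : ℝ ↦ Real.log (normTheta τ (x + s * (N + M * τ)))) 1
  rw [sub_self, sub_zero] at h2
  rw [lineMean, lineMean, ← h2]
  refine intervalIntegral.integral_congr fun s _ ↦ ?_
  rw [← normTheta_neg hτ, ← normTheta_add_lattice hτ _ N M]
  congr 2
  push_cast
  ring

theorem continuous_log_normTheta (hτ : 0 < τ.im) {x : ℂ}
    (hx : ∀ n : ℤ, lineCoord N M τ x ≠ n) :
    Continuous fun s : ℝ ↦ Real.log (normTheta τ (x + s * (N + M * τ))) := by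
  refine Continuous.log ((continuous_normTheta hτ).comp (by fun_prop)) fun s ↦ ?_
  refine (normTheta_pos (addTheta_ne_zero_of_lineCoord N M hτ fun n ↦ ?_)).ne'
  rw [lineCoord_add, lineCoord_ofReal_mul, lineCoord_period N M hτ, mul_zero, add_zero]
  exact hx n

end

section

variable {τ : ℂ} {N M : ℤ}

theorem integral_quadratic (a b c : ℝ) :
    (∫ s in (0 : ℝ)..1, (a + b * s + c * s ^ 2)) = a + b / 2 + c / 3 := by
  rw [intervalIntegral.integral_add (by apply Continuous.intervalIntegrable; fun_prop)
    (by apply Continuous.intervalIntegrable; fun_prop),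
    intervalIntegral.integral_add (by apply Continuous.intervalIntegrable; fun_prop)
    (by apply Continuous.intervalIntegrable; fun_prop),
    intervalIntegral.integral_const_mul, intervalIntegral.integral_const_mul,
    integral_id, integral_pow, intervalIntegral.integral_const]
  norm_num
  ring

theorem lineCoord_ne_int_of_mem_Ioo {x : ℂ} (h0 : 0 < lineCoord N M τ x)
    (h1 : lineCoord N M τ x < 1) (n : ℤ) : lineCoord N M τ x ≠ n := by
  intro h
  rw [h] at h0 h1
  norm_cast at h0 h1
  omega

/-- The strip contains no lattice point, hence no zero of theta. The real part comes from the
holomorphic logarithm, the rest from integrating the Gaussian exponent. -/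
theorem exists_lineMean_eq_on_strip (hτ : 0 < τ.im) (h : Int.gcd N M = 1) :
    ∃ c c' : ℂ, ∀ x, 0 < lineCoord N M τ x → lineCoord N M τ x < 1 →
      lineMean N M τ x
        = (-(Real.pi * Complex.I * M / (N + M * τ)) * x ^ 2 + c * x + c').re
          + (-(Real.pi / τ.im) * (x.im ^ 2 + x.im * (M * τ.im) + (M * τ.im) ^ 2 / 3)
            + Real.pi * (x.im + M * τ.im / 2)) := by
  set ω : ℂ := N + M * τ with hω
  have hω0 : ω ≠ 0 := period_ne_zero hτ h
  have hωim : ω.im = M * τ.im := by simp [hω]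
  set S : Set ℂ := {x | 0 < lineCoord N M τ x ∧ lineCoord N M τ x < 1} with hS
  have hSo : IsOpen S := (isOpen_lt continuous_const (continuous_lineCoord N M)).inter
    (isOpen_lt (continuous_lineCoord N M) continuous_const)
  have hlin : IsLinearMap ℝ (lineCoord N M τ) :=
    ⟨lineCoord_add N M, fun t x ↦ by rw [Complex.real_smul, lineCoord_ofReal_mul, smul_eq_mul]⟩
  have hSc : Convex ℝ S := (convex_halfSpace_gt hlin 0).inter (convex_halfSpace_lt hlin 1)
  have hSω : ∀ x ∈ S, ∀ t : ℝ, x + t * ω ∈ S := fun x hx t ↦ by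
    have : lineCoord N M τ (x + t * ω) = lineCoord N M τ x := by
      rw [lineCoord_add, lineCoord_ofReal_mul, hω, lineCoord_period N M hτ, mul_zero, add_zero]
    simpa only [hS, Set.mem_ofPred_eq, this] using hx
  have hne : ∀ x ∈ S, addTheta τ x ≠ 0 := fun x hx ↦
    addTheta_ne_zero_of_lineCoord N M hτ (lineCoord_ne_int_of_mem_Ioo hx.1 hx.2)
  obtain ⟨κ, -, hκ⟩ := addTheta_add_int_mul_tau hτ M
  obtain ⟨c, c', hc⟩ := exists_integral_log_norm_eq_quadratic hSc hSo
    (differentiable_addTheta hτ).differentiableOn hne hω0 hSω (κ := κ)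
    (k := 2 * Real.pi * Complex.I * M) (fun x _ ↦ by
      rw [← hκ, hω, ← addTheta_add_int (x + M * τ) N]
      congr 1
      ring)
  refine ⟨c, c', fun x h0 h1 ↦ ?_⟩
  have hx : x ∈ S := ⟨h0, h1⟩
  have e : ∀ s : ℝ, Real.log (normTheta τ (x + s * ω)) = Real.log ‖addTheta τ (x + s * ω)‖
      + ((-(Real.pi / τ.im) * x.im ^ 2 + Real.pi * x.im)
        + (-(Real.pi / τ.im) * (2 * x.im * ω.im) + Real.pi * ω.im) * s
        + (-(Real.pi / τ.im) * ω.im ^ 2) * s ^ 2) := fun s ↦ by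
    rw [log_norm_addTheta (hne _ (hSω x hx s)), Complex.add_im, Complex.im_ofReal_mul]
    ring
  have hcont : Continuous fun s : ℝ ↦ Real.log ‖addTheta τ (x + s * ω)‖ :=
    Continuous.log (((differentiable_addTheta hτ).continuous.comp (by fun_prop)).norm)
      fun s ↦ norm_ne_zero_iff.2 (hne _ (hSω x hx s))
  rw [lineMean]
  simp only [← hω, e]
  rw [intervalIntegral.integral_add (hcont.intervalIntegrable _ _)
    (by apply Continuous.intervalIntegrable; fun_prop), hc x hx, integral_quadratic, hωim]
  have e2 : 2 * Real.pi * Complex.I * M / (2 * ω) = Real.pi * Complex.I * M / ω := by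
    field_simp
  rw [e2]
  ring

/-- Bézout completes the primitive vector `N + M τ` to a lattice basis by `b + a τ`. -/
theorem exists_lattice_lineCoord_eq_one (h : Int.gcd N M = 1) : ∃ a b : ℤ, M * b - N * a = 1 := by
  refine ⟨-Int.gcdA N M, Int.gcdB N M, ?_⟩
  have := Int.gcd_eq_gcd_ab N M
  rw [h] at this
  push_cast at this
  linarith

/-- This is the `t²` coefficient of `lineMean` at `t (b + a τ)`. After clearing denominators it
reduces to `-(M b - N a)² = -1`. -/
theorem quadratic_coeff_eq (hτ : 0 < τ.im) (h : Int.gcd N M = 1) {a b : ℤ}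
    (hab : M * b - N * a = 1) :
    (-(Real.pi * Complex.I * M / (N + M * τ)) * (b + a * τ) ^ 2).re
      - Real.pi / τ.im * (a * τ.im) ^ 2
      = -(Real.pi * τ.im / ‖(N : ℂ) + M * τ‖ ^ 2) := by
  have hω0 := period_ne_zero hτ h
  have hn : (0 : ℝ) < ‖(N : ℂ) + M * τ‖ ^ 2 := by positivity
  have hab' : (M : ℝ) * b - N * a = 1 := by exact_mod_cast hab
  have e : -(Real.pi * Complex.I * M / (N + M * τ)) * (b + a * τ) ^ 2
      = ((Real.pi * M / ‖(N : ℂ) + M * τ‖ ^ 2 : ℝ) : ℂ)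
        * (-Complex.I * ((b + a * τ) ^ 2 * (starRingEnd ℂ) (N + M * τ))) := by
    push_cast
    rw [← Complex.mul_conj']
    have h2 : (starRingEnd ℂ) ((N : ℂ) + M * τ) ≠ 0 :=
      (map_ne_zero _).2 hω0
    field_simp
  rw [e, Complex.re_ofReal_mul]
  have hn2 : ‖(N : ℂ) + M * τ‖ ^ 2 = (N + M * τ.re) ^ 2 + (M * τ.im) ^ 2 := by
    rw [Complex.sq_norm, Complex.normSq_apply]
    simp
    ring
  rw [hn2] at hn ⊢
  have e3 : (-Complex.I * ((b + a * τ) ^ 2 * (starRingEnd ℂ) (N + M * τ))).re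
      = 2 * (b + a * τ.re) * (a * τ.im) * (N + M * τ.re)
        - ((b + a * τ.re) ^ 2 - (a * τ.im) ^ 2) * (M * τ.im) := by
    simp [pow_two]
    ring
  rw [e3]
  have key : (M : ℝ) * (2 * (b + a * τ.re) * a * (N + M * τ.re)
        - ((b + a * τ.re) ^ 2 - (a * τ.im) ^ 2) * M)
      - a ^ 2 * ((N + M * τ.re) ^ 2 + (M * τ.im) ^ 2) = -1 := by
    have : (M : ℝ) * (2 * (b + a * τ.re) * a * (N + M * τ.re)
        - ((b + a * τ.re) ^ 2 - (a * τ.im) ^ 2) * M)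
      - a ^ 2 * ((N + M * τ.re) ^ 2 + (M * τ.im) ^ 2) = -(M * b - N * a) ^ 2 := by ring
    rw [this, hab']
    norm_num
  generalize ((N : ℝ) + M * τ.re) ^ 2 + (M * τ.im) ^ 2 = D at hn key ⊢
  have hD := hn.ne'
  have hτ' := hτ.ne'
  field_simp
  linear_combination key

/-- The mean of `log normTheta` along closed geodesics in direction `N + M τ`. -/
theorem exists_lineMean_eq (hτ : 0 < τ.im) (h : Int.gcd N M = 1) :
    ∃ C : ℝ, ∀ x, (∀ n : ℤ, lineCoord N M τ x ≠ n) →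
      lineMean N M τ x = C - Real.pi * τ.im / ‖(N : ℂ) + M * τ‖ ^ 2
        * (Int.fract (lineCoord N M τ x) * (Int.fract (lineCoord N M τ x) - 1)) := by
  obtain ⟨a, b, hab⟩ := exists_lattice_lineCoord_eq_one h
  obtain ⟨c, c', hc⟩ := exists_lineMean_eq_on_strip hτ h
  have hquad := quadratic_coeff_eq hτ h hab
  set A := Real.pi * τ.im / ‖(N : ℂ) + M * τ‖ ^ 2
  set e : ℂ := b + a * τ with he
  have hab' : (M : ℝ) * b - N * a = 1 := by exact_mod_cast hab
  have he1 : lineCoord N M τ e = 1 := by rw [he, lineCoord_lattice N M hτ, hab']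
  have heim : e.im = a * τ.im := by simp [he]
  have hcoord : ∀ t : ℝ, lineCoord N M τ (t * e) = t := fun t ↦ by
    rw [lineCoord_ofReal_mul, he1, mul_one]
  obtain ⟨k1, k0, hk⟩ : ∃ k1 k0 : ℝ, ∀ t : ℝ, 0 < t → t < 1 →
      lineMean N M τ (t * e) = -A * t ^ 2 + k1 * t + k0 := by
    refine ⟨(c * e).re + -(Real.pi / τ.im) * (e.im * (M * τ.im)) + Real.pi * e.im,
      c'.re + -(Real.pi / τ.im) * ((M * τ.im) ^ 2 / 3) + Real.pi * (M * τ.im / 2),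
      fun t h0 h1 ↦ ?_⟩
    rw [hc _ (by rwa [hcoord]) (by rwa [hcoord]), ← hquad, Complex.im_ofReal_mul, ← heim]
    have e1 : -(Real.pi * Complex.I * M / (N + M * τ)) * (t * e) ^ 2 + c * (t * e) + c'
        = ((t ^ 2 : ℝ) : ℂ) * (-(Real.pi * Complex.I * M / (N + M * τ)) * e ^ 2)
          + (t : ℂ) * (c * e) + c' := by
      push_cast
      ring
    rw [e1, Complex.add_re, Complex.add_re, Complex.re_ofReal_mul, Complex.re_ofReal_mul]
    ring
  -- Evenness and the period `e` give the symmetry `t ↦ 1 - t`; the single pair `1/4, 3/4` already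
  -- determines `k1`.
  have hsymm : lineMean N M τ ((3 / 4 : ℝ) * e) = lineMean N M τ ((1 / 4 : ℝ) * e) := by
    rw [← lineMean_neg hτ, ← lineMean_add_lattice hτ _ b a, ← he]
    congr 1
    push_cast
    ring
  rw [hk _ (by norm_num) (by norm_num), hk _ (by norm_num) (by norm_num)] at hsymm
  have hk1 : k1 = A := by linarith
  refine ⟨k0, fun x hx ↦ ?_⟩
  obtain ⟨u, hu⟩ := exists_eq_add_period (x := x) hτ h he1
  set ρ := lineCoord N M τ x
  have hf0 : 0 < Int.fract ρ := Int.fract_pos.2 (hx _)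
  have hf1 : Int.fract ρ < 1 := Int.fract_lt_one ρ
  have e2 : (ρ : ℂ) * e = (Int.fract ρ : ℝ) * e
      + (((⌊ρ⌋ * b : ℤ) : ℂ) + ((⌊ρ⌋ * a : ℤ) : ℂ) * τ) := by
    have : (ρ : ℂ) = (⌊ρ⌋ : ℂ) + (Int.fract ρ : ℝ) := by
      exact_mod_cast (Int.floor_add_fract ρ).symm
    rw [he]
    push_cast
    linear_combination (b + a * τ) * this
  rw [hu, lineMean_add_period hτ, e2, lineMean_add_lattice hτ, hk _ hf0 hf1, hk1]
  ring

/-- Weyl averages of `log normTheta` along the line in direction `N + M τ`. -/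
theorem tendsto_average_log_normTheta (hτ : 0 < τ.im) {χ : ℝ} (hχ : Irrational χ) {x : ℂ}
    (hx : ∀ n : ℤ, lineCoord N M τ x ≠ n) :
    Tendsto (fun n : ℕ ↦ (n : ℝ)⁻¹ * ∑ m ∈ Finset.range n,
      Real.log (normTheta τ (x + (m * χ : ℝ) * (N + M * τ)))) atTop (𝓝 (lineMean N M τ x)) :=
  tendsto_average_periodic hχ (continuous_log_normTheta hτ hx) (periodic_log_normTheta hτ x)

end

/-! ### Logarithmic coordinates and elliptic shifted factorials. -/

section

variable {τ : ℂ} {N M : ℤ}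

/-- A logarithmic coordinate compatible with `lineFract`. -/
theorem exists_log_coord (N M : ℤ) (τ : ℂ) {t : ℂ} (ht : t ≠ 0) :
    ∃ x : ℂ, Complex.exp (2 * Real.pi * Complex.I * x) = t ∧
      lineFract N M τ t = Int.fract (lineCoord N M τ x) ∧
      x.im = -(Real.log ‖t‖ / (2 * Real.pi)) := by
  set y := Complex.log (starRingEnd ℂ t) with hy
  have hct : starRingEnd ℂ t ≠ 0 := (map_ne_zero _).2 ht
  have hyre : y.re = Real.log ‖t‖ := by rw [hy, Complex.log_re, Complex.norm_conj]
  have hxre : (-Complex.I * starRingEnd ℂ y / ((2 * Real.pi : ℝ) : ℂ)).re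
      = -y.im / (2 * Real.pi) := by
    rw [Complex.div_ofReal_re]
    simp
  have hxim : (-Complex.I * starRingEnd ℂ y / ((2 * Real.pi : ℝ) : ℂ)).im
      = -(y.re / (2 * Real.pi)) := by
    rw [Complex.div_ofReal_im]
    simp
    ring
  -- The conjugate of `y = log (conj t)` is a logarithm of `t`; dividing it by `2πi` gives `x`.
  refine ⟨-Complex.I * starRingEnd ℂ y / ((2 * Real.pi : ℝ) : ℂ), ?_, ?_, ?_⟩
  · have : 2 * Real.pi * Complex.I * (-Complex.I * starRingEnd ℂ y / ((2 * Real.pi : ℝ) : ℂ))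
        = starRingEnd ℂ y := by
      push_cast
      field_simp
      rw [Complex.I_sq]
      ring
    rw [this, Complex.exp_conj, hy, Complex.exp_log hct, Complex.conj_conj]
  · rw [lineFract, lineCoord, ← hy, hxre, hxim]
    congr 1
    simp only [Complex.mul_re, Complex.add_re, Complex.add_im, Complex.intCast_re,
      Complex.intCast_im, Complex.mul_im]
    field_simp
    ring
  · rw [hxim, hyre]

/-- Coordinate `n` means `x = n (b + a τ) + u (N + M τ)`, which exponentiates to `p^(n a) q^(u/χ)`,
a point of the excluded line. -/
theorem lineCoord_ne_int_of_exp_ne (hτ : 0 < τ.im) (h : Int.gcd N M = 1) {χ : ℝ} (hχ : χ ≠ 0)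
    {x : ℂ}
    (hx : ∀ (j : ℤ) (s : ℝ), Complex.exp (2 * Real.pi * Complex.I * x)
      ≠ Complex.exp (2 * Real.pi * Complex.I * τ) ^ j
        * Complex.exp (s * (2 * Real.pi * Complex.I * χ * (N + M * τ)))) (n : ℤ) :
    lineCoord N M τ x ≠ n := by
  intro hn
  obtain ⟨a, b, hab⟩ := exists_lattice_lineCoord_eq_one h
  have he1 : lineCoord N M τ (b + a * τ) = 1 := by
    rw [lineCoord_lattice N M hτ]
    exact_mod_cast hab
  obtain ⟨u, hu⟩ := exists_eq_add_period (x := x) hτ h he1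
  rw [hn] at hu
  refine hx (n * a) (u / χ) ?_
  rw [← Complex.exp_int_mul, ← Complex.exp_add, Complex.exp_eq_exp_iff_exists_int]
  refine ⟨n * b, ?_⟩
  have hχ' : (χ : ℂ) ≠ 0 := by exact_mod_cast hχ
  rw [hu]
  push_cast
  field_simp
  ring

theorem mulTheta_exp_mul_pow (x : ℂ) (χ : ℝ) (m : ℕ) :
    mulTheta (Complex.exp (2 * Real.pi * Complex.I * x)
      * Complex.exp (2 * Real.pi * Complex.I * χ * (N + M * τ)) ^ m)
      (Complex.exp (2 * Real.pi * Complex.I * τ))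
      = addTheta τ (x + (m * χ : ℝ) * (N + M * τ)) := by
  rw [addTheta, ← Complex.exp_nat_mul, ← Complex.exp_add]
  congr 2
  push_cast
  ring

theorem addTheta_line_ne_zero (hτ : 0 < τ.im) {x : ℂ} (hx : ∀ n : ℤ, lineCoord N M τ x ≠ n)
    (s : ℝ) : addTheta τ (x + s * (N + M * τ)) ≠ 0 := by
  refine addTheta_ne_zero_of_lineCoord N M hτ fun n ↦ ?_
  rw [lineCoord_add, lineCoord_ofReal_mul, lineCoord_period N M hτ, mul_zero, add_zero]
  exact hx n

theorem ellPoch_ne_zero (hτ : 0 < τ.im) {x : ℂ} (hx : ∀ n : ℤ, lineCoord N M τ x ≠ n) (χ : ℝ)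
    (n : ℕ) : ellPoch (Complex.exp (2 * Real.pi * Complex.I * x))
      (Complex.exp (2 * Real.pi * Complex.I * τ))
      (Complex.exp (2 * Real.pi * Complex.I * χ * (N + M * τ))) n ≠ 0 := by
  rw [ellPoch]
  refine Finset.prod_ne_zero_iff.2 fun m _ ↦ ?_
  rw [mulTheta_exp_mul_pow]
  exact addTheta_line_ne_zero hτ hx _

/-- This orbit lies on a line through the lattice, so the transverse coordinate cannot help. A zero
would make `χ (m + 1) N` and `χ (m + 1) M` both integers, against irrationality. -/
theorem ellPoch_self_ne_zero (hτ : 0 < τ.im) (h : Int.gcd N M = 1) {χ : ℝ} (hχ : Irrational χ)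
    (n : ℕ) : ellPoch (Complex.exp (2 * Real.pi * Complex.I * χ * (N + M * τ)))
      (Complex.exp (2 * Real.pi * Complex.I * τ))
      (Complex.exp (2 * Real.pi * Complex.I * χ * (N + M * τ))) n ≠ 0 := by
  rw [ellPoch]
  refine Finset.prod_ne_zero_iff.2 fun m _ ↦ ?_
  have e : (2 * Real.pi * Complex.I * χ * (N + M * τ) : ℂ)
      = 2 * Real.pi * Complex.I * (χ * (N + M * τ)) := by ring
  have e2 := mulTheta_exp_mul_pow (N := N) (M := M) (τ := τ) (χ * (N + M * τ)) χ m
  rw [← e] at e2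
  rw [e2]
  refine addTheta_ne_zero hτ fun a b hab ↦ ?_
  have hirr : ∀ k j : ℤ, k ≠ 0 → χ * (m + 1) * k ≠ j := fun k j hk hkj ↦ by
    have h1 : ((m + 1 : ℤ) * k) ≠ 0 := mul_ne_zero (by omega) hk
    refine (hχ.intCast_mul h1).ne_int j ?_
    push_cast
    linarith
  have him := congr_arg Complex.im hab
  have hre := congr_arg Complex.re hab
  simp only [Complex.add_im, Complex.add_re, Complex.ofReal_re, Complex.ofReal_im,
    Complex.intCast_im, Complex.intCast_re, Complex.mul_im, Complex.mul_re, zero_mul, zero_add,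
    add_zero, sub_zero] at him hre
  have h1 : χ * (m + 1) * M = b := by
    apply mul_right_cancel₀ hτ.ne'
    linear_combination him
  have h2 : χ * (m + 1) * N = a := by linear_combination hre - τ.re * h1
  rcases eq_or_ne M 0 with rfl | hM
  · refine hirr N a (fun hN ↦ ?_) h2
    simp [hN] at h
  · exact hirr M b hM h1

/-- Separates the terms by their dependence on `x`: periodic part, quadratic, linear and independent
of `x`. -/
theorem log_norm_ellPoch (hτ : 0 < τ.im) {x : ℂ} (hx : ∀ n : ℤ, lineCoord N M τ x ≠ n) (χ : ℝ)
    (n : ℕ) : Real.log ‖ellPoch (Complex.exp (2 * Real.pi * Complex.I * x))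
      (Complex.exp (2 * Real.pi * Complex.I * τ))
      (Complex.exp (2 * Real.pi * Complex.I * χ * (N + M * τ))) n‖
      = ∑ m ∈ Finset.range n, Real.log (normTheta τ (x + (m * χ : ℝ) * (N + M * τ)))
        + n * (Real.pi / τ.im * x.im ^ 2)
        + x.im * ∑ m ∈ Finset.range n, (2 * Real.pi * M * (m * χ) - Real.pi)
        + ∑ m ∈ Finset.range n, (Real.pi * τ.im * (m * χ * M) ^ 2 - Real.pi * (m * χ * M * τ.im)) := by
  rw [ellPoch, norm_prod, Real.log_prod (fun m _ ↦ by
    rw [mulTheta_exp_mul_pow]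
    exact norm_ne_zero_iff.2 (addTheta_line_ne_zero hτ hx _)), Finset.mul_sum]
  have : (n : ℝ) * (Real.pi / τ.im * x.im ^ 2)
      = ∑ m ∈ Finset.range n, Real.pi / τ.im * x.im ^ 2 := by simp
  rw [this, ← Finset.sum_add_distrib, ← Finset.sum_add_distrib, ← Finset.sum_add_distrib]
  refine Finset.sum_congr rfl fun m _ ↦ ?_
  rw [mulTheta_exp_mul_pow, log_norm_addTheta (addTheta_line_ne_zero hτ hx _), Complex.add_im,
    Complex.im_ofReal_mul]
  simp only [Complex.add_im, Complex.intCast_im, Complex.mul_im, Complex.intCast_re]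
  field_simp
  ring

theorem thetaHypCoeff_eq_prod_div {r : ℕ} {t : Fin (r + 1) → ℂ} {w : Fin r → ℂ} {p q : ℂ}
    (ht0 : t 0 = q) {n : ℕ} (hq : ellPoch q p q n ≠ 0) :
    thetaHypCoeff t w q p n = ∏ k, ellPoch (t (Fin.succ k)) p q n / ellPoch (w k) p q n := by
  rw [thetaHypCoeff, Fin.prod_univ_succ, ht0, Finset.prod_div_distrib, mul_div_mul_left _ _ hq]

end

/-! ### Radius of convergence. -/

theorem theorem5 (r : ℕ) (τ : ℂ) (hτ : 0 < τ.im) (N M : ℤ) (hNM : Int.gcd N M = 1)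
    (χ : ℝ) (hχ : Irrational χ) (p q : ℂ)
    (hp : p = Complex.exp (2 * Real.pi * Complex.I * τ))
    (hq : q = Complex.exp (2 * Real.pi * Complex.I * χ * (N + M * τ)))
    (t : Fin (r + 1) → ℂ) (w : Fin r → ℂ)
    (ht : ∀ k, t k ≠ 0) (hw : ∀ k, w k ≠ 0)
    (ht0 : t 0 = q)
    (hbal : ∏ k, t k = q * ∏ k, w k)
    (htline : ∀ (k : Fin r) (j : ℤ) (s : ℝ),
      t k.succ ≠ p ^ j * Complex.exp (s * (2 * Real.pi * Complex.I * χ * (N + M * τ))))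
    (hwline : ∀ (k : Fin r) (j : ℤ) (s : ℝ),
      w k ≠ p ^ j * Complex.exp (s * (2 * Real.pi * Complex.I * χ * (N + M * τ)))) :
    ∃ rc : ℝ, 0 < rc ∧ (thetaHypSeries t w q p).radius = ENNReal.ofReal rc ∧
      Real.log rc⁻¹ = ∑ k : Fin r,
        ((Real.log ‖t k.succ‖ ^ 2 - Real.log ‖w k‖ ^ 2) / (4 * Real.pi * τ.im)
          + Real.pi * τ.im / ‖(N : ℂ) + M * τ‖ ^ 2
            * (lineFract N M τ (w k) * (lineFract N M τ (w k) - 1)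
              - lineFract N M τ (t k.succ) * (lineFract N M τ (t k.succ) - 1))) := by
  choose x hxt hxf hxi using fun k : Fin r ↦ exists_log_coord N M τ (ht k.succ)
  choose y hyw hyf hyi using fun k : Fin r ↦ exists_log_coord N M τ (hw k)
  have hx : ∀ k, ∀ n : ℤ, lineCoord N M τ (x k) ≠ n := fun k ↦
    lineCoord_ne_int_of_exp_ne hτ hNM hχ.ne_zero fun j s ↦ by
      rw [hxt, ← hp]; exact htline k j s
  have hy : ∀ k, ∀ n : ℤ, lineCoord N M τ (y k) ≠ n := fun k ↦
    lineCoord_ne_int_of_exp_ne hτ hNM hχ.ne_zero fun j s ↦ by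
      rw [hyw, ← hp]; exact hwline k j s
  have hqn : ∀ n, ellPoch q p q n ≠ 0 := fun n ↦ by
    rw [hp, hq]; exact ellPoch_self_ne_zero hτ hNM hχ n
  have htn : ∀ k n, ellPoch (t (Fin.succ k)) p q n ≠ 0 := fun k n ↦ by
    rw [hp, hq, ← hxt]; exact ellPoch_ne_zero hτ (hx k) χ n
  have hwn : ∀ k n, ellPoch (w k) p q n ≠ 0 := fun k n ↦ by
    rw [hp, hq, ← hyw]; exact ellPoch_ne_zero hτ (hy k) χ n
  have hc0 : ∀ n, thetaHypCoeff t w q p n ≠ 0 := fun n ↦ by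
    rw [thetaHypCoeff_eq_prod_div ht0 (hqn n)]
    exact Finset.prod_ne_zero_iff.2 fun k _ ↦ div_ne_zero (htn k n) (hwn k n)
  -- Since `t 0 = q`, balancing reduces to equal products of the remaining parameters; only its
  -- modulus is used.
  have hsum : ∑ k, ((x k).im - (y k).im) = 0 := by
    rw [Fin.prod_univ_succ, ht0] at hbal
    have h1 := mul_left_cancel₀ (by rw [hq]; exact Complex.exp_ne_zero _) hbal
    have h2 := congr_arg (fun z : ℂ ↦ Real.log ‖z‖) h1
    simp only [norm_prod] at h2
    rw [Real.log_prod (fun k _ ↦ norm_ne_zero_iff.2 (ht _)),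
      Real.log_prod (fun k _ ↦ norm_ne_zero_iff.2 (hw _))] at h2
    simp only [hxi, hyi]
    rw [Finset.sum_sub_distrib, Finset.sum_neg_distrib, Finset.sum_neg_distrib,
      ← Finset.sum_div, ← Finset.sum_div, h2, sub_self]
  set avg : ℂ → ℕ → ℝ := fun z n ↦ (n : ℝ)⁻¹ * ∑ m ∈ Finset.range n,
    Real.log (normTheta τ (z + (m * χ : ℝ) * (N + M * τ))) with havg
  have hlog : ∀ n : ℕ, 0 < n → (n : ℝ)⁻¹ * Real.log ‖thetaHypCoeff t w q p n‖
      = ∑ k, (avg (x k) n - avg (y k) n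
        + Real.pi / τ.im * ((x k).im ^ 2 - (y k).im ^ 2)) := fun n hn ↦ by
    have hn' : (n : ℝ) ≠ 0 := by exact_mod_cast hn.ne'
    rw [thetaHypCoeff_eq_prod_div ht0 (hqn n), norm_prod, Real.log_prod (fun k _ ↦
      norm_ne_zero_iff.2 (div_ne_zero (htn k n) (hwn k n))), Finset.mul_sum]
    have hk : ∀ k : Fin r, (n : ℝ)⁻¹ * Real.log ‖ellPoch (t k.succ) p q n / ellPoch (w k) p q n‖
        = (avg (x k) n - avg (y k) n + Real.pi / τ.im * ((x k).im ^ 2 - (y k).im ^ 2))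
          + ((x k).im - (y k).im)
            * ((n : ℝ)⁻¹ * ∑ m ∈ Finset.range n, (2 * Real.pi * M * (m * χ) - Real.pi)) :=
      fun k ↦ by
        rw [norm_div, Real.log_div (norm_ne_zero_iff.2 (htn k n)) (norm_ne_zero_iff.2 (hwn k n)),
          hp, hq, ← hxt, ← hyw, log_norm_ellPoch hτ (hx k), log_norm_ellPoch hτ (hy k)]
        simp only [havg]
        generalize ∑ m ∈ Finset.range n,
          Real.log (normTheta τ (x k + (m * χ : ℝ) * (N + M * τ))) = X
        generalize ∑ m ∈ Finset.range n,
          Real.log (normTheta τ (y k + (m * χ : ℝ) * (N + M * τ))) = Y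
        generalize ∑ m ∈ Finset.range n, (2 * Real.pi * M * (m * χ) - Real.pi) = R
        generalize ∑ m ∈ Finset.range n,
          (Real.pi * τ.im * (m * χ * M) ^ 2 - Real.pi * (m * χ * M * τ.im)) = Z
        field_simp
        ring
    simp only [hk]
    -- Without balancing, this averaged linear term would diverge for `M ≠ 0`.
    rw [Finset.sum_add_distrib, ← Finset.sum_mul, hsum, zero_mul, add_zero]
  have htend : Tendsto (fun n : ℕ ↦ (n : ℝ)⁻¹ * Real.log ‖thetaHypCoeff t w q p n‖) atTop
      (𝓝 (∑ k, (lineMean N M τ (x k) - lineMean N M τ (y k)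
        + Real.pi / τ.im * ((x k).im ^ 2 - (y k).im ^ 2)))) := by
    refine Tendsto.congr' ?_ (tendsto_finsetSum _ fun k _ ↦
      ((tendsto_average_log_normTheta hτ hχ (hx k)).sub
        (tendsto_average_log_normTheta hτ hχ (hy k))).add tendsto_const_nhds)
    filter_upwards [eventually_gt_atTop 0] with n hn using (hlog n hn).symm
  refine ⟨_, Real.exp_pos _, radius_ofScalars_of_tendsto_log hc0 htend, ?_⟩
  rw [← Real.exp_neg, neg_neg, Real.log_exp]
  -- The same `C` serves `x k` and `y k`, so it drops out of the difference.
  obtain ⟨C, hC⟩ := exists_lineMean_eq hτ hNM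
  refine Finset.sum_congr rfl fun k _ ↦ ?_
  rw [hC _ (hx k), hC _ (hy k), ← hxf, ← hyf, hxi, hyi]
  have := Real.pi_ne_zero
  field_simp
  ring
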